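/- Let $d\ge 1$, let $0<\alpha<2$, and let $\beta\in C_c^\infty(\mathbb{R}^d)$ be a smooth compactly supported (complex-valued) function. Write $\hat u$ for the Fourier transform of a tempered distribution $u$ on $\mathbb{R}^d$, normalized by $\hat\varphi(\xi)=\int_{\mathbb{R}^d}e^{-2\pi i x\cdot\xi}\varphi(x)\,dx$ for Schwartz functions $\varphi$. For $s\in\mathbb{R}$ let $H^s(\mathbb{R}^d)$ be the space of tempered distributions $u$ with $\|u\|_{H^s}:=\|(1+|\xi|^2)^{s/2}\hat u(\xi)\|_{L^2(\mathbb{R}^d)}<\infty$. Let $(-\Delta)^{\alpha/2}$ be the Fourier multiplier with $\widehat{(-\Delta)^{\alpha/2}u}(\xi)=(2\pi|\xi|)^{\alpha}\hat u(\xi)$, defined for tempered distributions $u$ such that $\hat u$ and $(2\pi|\xi|)^\alpha\hat u$ are functions whose products with all Schwartz functions are integrable. Then there is a constant $C>0$, depending only on $d$, $\alpha$ and $\beta$, such that for every $u\in H^{\alpha-1}(\mathbb{R}^d)$ both $(-\Delta)^{\alpha/2}u$ and $(-\Delta)^{\alpha/2}(\beta u)$ are defined, the commutator $$[\beta,(-\Delta)^{\alpha/2}]u:=\beta\,(-\Delta)^{\alpha/2}u-(-\Delta)^{\alpha/2}(\beta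 u)$$ belongs to $L^2(\mathbb{R}^d)$, and $$\|[\beta,(-\Delta)^{\alpha/2}]u\|_{L^2(\mathbb{R}^d)}\le C\,\|u\|_{H^{\alpha-1}(\mathbb{R}^d)}.$$ -/

import Mathlib

open MeasureTheory TemperedDistribution FourierTransform
open scoped SchwartzMap ContDiff

noncomputable section

/-- The Fourier transform of the tempered distribution `u` is the function `g`: the product of `g`
with every Schwartz function is integrable, and `𝓕 u` acts by integration against `g`.
(Mathlib's convention: `𝓕 φ ξ = ∫ exp (-2πi x·ξ) φ x dx`.) -/
structure HasFourierDensity {d : ℕ} (u : 𝓢'(EuclideanSpace ℝ (Fin d), ℂ))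
    (g : EuclideanSpace ℝ (Fin d) → ℂ) : Prop where
  integrable : ∀ φ : 𝓢(EuclideanSpace ℝ (Fin d), ℂ), Integrable (fun ξ => φ ξ * g ξ)
  apply_eq : ∀ φ : 𝓢(EuclideanSpace ℝ (Fin d), ℂ), (𝓕 u) φ = ∫ ξ, φ ξ * g ξ

/-- `v = (-Δ)^{α/2} u`, as a Fourier multiplier: `𝓕 u` is a function `g` and `𝓕 v` is the function
`(2π|ξ|)^α g(ξ)`. The factor `2π` comes from Mathlib's convention for the Fourier transform, in
which `-Δ` has the symbol `(2π|ξ|)²`. -/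
def HasFracLaplacian {d : ℕ} (α : ℝ) (u v : 𝓢'(EuclideanSpace ℝ (Fin d), ℂ)) : Prop :=
  ∃ g : EuclideanSpace ℝ (Fin d) → ℂ, HasFourierDensity u g ∧
    HasFourierDensity v (fun ξ => (((2 * Real.pi * ‖ξ‖) ^ α : ℝ) : ℂ) * g ξ)

open Classical in
/-- The fractional Laplacian `(-Δ)^{α/2} u` of a tempered distribution, with the value `0` where
it is not defined. -/
def fracLaplacian {d : ℕ} (α : ℝ) (u : 𝓢'(EuclideanSpace ℝ (Fin d), ℂ)) :
    𝓢'(EuclideanSpace ℝ (Fin d), ℂ) :=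
  if h : ∃ v, HasFracLaplacian α u v then h.choose else 0

/-- The commutator `[β, (-Δ)^{α/2}] u = β (-Δ)^{α/2} u - (-Δ)^{α/2} (β u)`. -/
def fracCommutator {d : ℕ} (α : ℝ) (β : EuclideanSpace ℝ (Fin d) → ℂ)
    (u : 𝓢'(EuclideanSpace ℝ (Fin d), ℂ)) : 𝓢'(EuclideanSpace ℝ (Fin d), ℂ) :=
  smulLeftCLM ℂ β (fracLaplacian α u) - fracLaplacian α (smulLeftCLM ℂ β u)

open Classical in
/-- The norm `‖u‖_{H^s} = ‖(1 + |ξ|²)^{s/2} 𝓕 u‖_{L²}` of `H^s`, equal by Plancherel's theorem to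
the `L²` norm of the Bessel potential of `u`; it has the value `0` outside `H^s`. -/
def sobolevNorm {d : ℕ} (s : ℝ) (u : 𝓢'(EuclideanSpace ℝ (Fin d), ℂ)) : ℝ :=
  if h : MemSobolev s 2 u then ‖h.choose‖ else 0

theorem HasFourierDensity.locallyIntegrable {d : ℕ} {u : 𝓢'(EuclideanSpace ℝ (Fin d), ℂ)}
    {g : EuclideanSpace ℝ (Fin d) → ℂ} (h : HasFourierDensity u g) : LocallyIntegrable g := by
  rw [locallyIntegrable_iff]
  intro K hK
  obtain ⟨f, hf1, -, hf2, hf3, -⟩ : ∃ f : EuclideanSpace ℝ (Fin d) → ℝ,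
      (∀ x ∈ K, f x = 1) ∧ True ∧ HasCompactSupport f ∧ ContDiff ℝ ∞ f ∧ True := by
    obtain ⟨r, hr, hKr⟩ := hK.isBounded.subset_ball_lt 0 0
    let b : ContDiffBump (0 : EuclideanSpace ℝ (Fin d)) := ⟨r, r + 1, hr, by linarith⟩
    exact ⟨b, fun x hx => b.one_of_mem_closedBall (Metric.ball_subset_closedBall (hKr hx)), trivial,
      b.hasCompactSupport, b.contDiff, trivial⟩
  have hc : HasCompactSupport (Complex.ofRealCLM ∘ f) := hf2.comp_left rfl
  have hs : ContDiff ℝ ∞ (Complex.ofRealCLM ∘ f) := Complex.ofRealCLM.contDiff.comp hf3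
  have := (h.integrable (hc.toSchwartzMap hs)).integrableOn (s := K)
  refine this.congr_fun (fun x hx => ?_) hK.measurableSet
  simp [hf1 x hx]

theorem HasFourierDensity.ae_unique {d : ℕ} {u : 𝓢'(EuclideanSpace ℝ (Fin d), ℂ)}
    {g g' : EuclideanSpace ℝ (Fin d) → ℂ} (h : HasFourierDensity u g)
    (h' : HasFourierDensity u g') : g =ᵐ[volume] g' := by
  refine ae_eq_of_integral_contDiff_smul_eq h.locallyIntegrable h'.locallyIntegrable ?_
  intro f hf hfc
  have hc : HasCompactSupport (Complex.ofRealCLM ∘ f) := hfc.comp_left rfl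
  have hs : ContDiff ℝ ∞ (Complex.ofRealCLM ∘ f) := Complex.ofRealCLM.contDiff.comp hf
  have e := (h.apply_eq (hc.toSchwartzMap hs)).symm.trans (h'.apply_eq (hc.toSchwartzMap hs))
  simpa using e

/-- `(-Δ)^{α/2} u` is unique. -/
theorem HasFracLaplacian.unique {d : ℕ} {α : ℝ} {u v w : 𝓢'(EuclideanSpace ℝ (Fin d), ℂ)}
    (hv : HasFracLaplacian α u v) (hw : HasFracLaplacian α u w) : v = w := by
  obtain ⟨g, hg, hgv⟩ := hv
  obtain ⟨g', hg', hgw⟩ := hw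
  have hae := hg.ae_unique hg'
  have : 𝓕 v = 𝓕 w := by
    ext φ
    rw [hgv.apply_eq, hgw.apply_eq]
    refine integral_congr_ae ?_
    filter_upwards [hae] with x hx
    rw [hx]
  simpa using congrArg (fun z : 𝓢'(EuclideanSpace ℝ (Fin d), ℂ) => 𝓕⁻ z) this

theorem HasFracLaplacian.fracLaplacian_eq {d : ℕ} {α : ℝ}
    {u v : 𝓢'(EuclideanSpace ℝ (Fin d), ℂ)} (hv : HasFracLaplacian α u v) :
    fracLaplacian α u = v := by
  have h : ∃ v, HasFracLaplacian α u v := ⟨v, hv⟩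
  rw [fracLaplacian, dif_pos h]
  exact h.choose_spec.unique hv

theorem sobolevNorm_eq {d : ℕ} {s : ℝ} {u : 𝓢'(EuclideanSpace ℝ (Fin d), ℂ)}
    {f : Lp ℂ 2 (volume : Measure (EuclideanSpace ℝ (Fin d)))}
    (hf : besselPotential (EuclideanSpace ℝ (Fin d)) ℂ s u = f) : sobolevNorm s u = ‖f‖ := by
  have h : MemSobolev s 2 u := ⟨f, hf⟩
  rw [sobolevNorm, dif_pos h]
  have e : Lp.toTemperedDistributionCLM ℂ volume 2 h.choose =
      Lp.toTemperedDistributionCLM ℂ volume 2 f := by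
    simpa using h.choose_spec.symm.trans hf
  rw [LinearMap.ker_eq_bot.mp (Lp.ker_toTemperedDistributionCLM_eq_bot (F := ℂ) (p := 2)
    (μ := (volume : Measure (EuclideanSpace ℝ (Fin d))))) e]

end

noncomputable section

open scoped ENNReal

/-! On the Fourier side the commutator is the integral operator with kernel `𝓕 β (ξ - η) *
((2π|η|)^α - (2π|ξ|)^α)` applied to `𝓕 u`, and `𝓕 u η = (1 + |η|²)^(-(α-1)/2) * h η` with `h ∈ L²`.
By `Real.abs_rpow_sub_rpow_le` the increment of the symbol is at most a constant times `(1 +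
|ξ-η|²)² (1 + |η|²)^((α-1)/2)`. The weights in `η` cancel, leaving a kernel dominated by convolution
with `(1 + |·|²)² |𝓕 β|`. This is integrable because `𝓕 β` is Schwartz, and Young's inequality `L¹ *
L² → L²` followed by Plancherel gives the bound.

The two terms of the commutator need not lie in `L²` separately. Both are handled in the class
`IsTemperedL2`, which is stable under the symbol and under convolution with `𝓕 β`, and whose members
are Fourier transforms of tempered distributions. -/

/-! ### Increments of powers. -/

/-- Dividing by `a ^ α` leaves `1 - 2(1 - r) ≤ r ^ α` for `r = b / a ∈ [0, 1]`: Bernoulli's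
inequality if `α ≥ 1`, and `r ≤ r ^ α` if `α ≤ 1`. -/
theorem Real.rpow_sub_rpow_le_two_mul {α a b : ℝ} (hα0 : 0 < α) (hα2 : α < 2) (hb : 0 ≤ b)
    (hba : b ≤ a) (ha : 0 < a) : a ^ α - b ^ α ≤ 2 * (a - b) * a ^ (α - 1) := by
  have hd : a ^ α = a * a ^ (α - 1) := by
    rw [Real.rpow_sub_one ha.ne']; field_simp
  have hp : 0 < a ^ (α - 1) := Real.rpow_pos_of_pos ha _
  have hbd : b ^ α = (b / a) ^ α * a ^ α := by
    rw [← Real.mul_rpow (by positivity) ha.le, div_mul_cancel₀ _ ha.ne']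
  have hr0 : 0 ≤ b / a := by positivity
  have hr1 : b / a ≤ 1 := (div_le_one ha).2 hba
  have key : 1 - 2 * (1 - b / a) ≤ (b / a) ^ α := by
    rcases le_total 1 α with h1 | h1
    · have := one_add_mul_self_le_rpow_one_add (s := b / a - 1) (by linarith) h1
      rw [add_sub_cancel] at this
      nlinarith
    · have : b / a ≤ (b / a) ^ α := by
        simpa using Real.rpow_le_rpow_of_exponent_ge' hr0 hr1 hα0.le h1
      linarith
  have e : a ^ α - (1 - 2 * (1 - b / a)) * a ^ α = 2 * (a - b) * a ^ (α - 1) := by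
    rw [hd]; field_simp; ring
  rw [hbd, ← e]
  have := mul_le_mul_of_nonneg_right key (Real.rpow_nonneg ha.le α)
  linarith

/-- The increment of `a ↦ a ^ α`, `0 < α < 2`, is controlled by the weight `(1 + b²)^{(α-1)/2}`
at one end point, up to a polynomial loss in the length of the interval. -/
theorem Real.abs_rpow_sub_rpow_le {α a b t : ℝ} (hα0 : 0 < α) (hα2 : α < 2) (ha : 0 ≤ a)
    (hb : 0 ≤ b) (hab : |a - b| ≤ t) :
    |a ^ α - b ^ α| ≤ 4 * (1 + t ^ 2) ^ 2 * (1 + b ^ 2) ^ ((α - 1) / 2) := by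
  have ht : 0 ≤ t := (abs_nonneg _).trans hab
  obtain ⟨hab1, hab2⟩ := abs_le.1 hab
  have htq : t ≤ 1 + t ^ 2 := by nlinarith [sq_nonneg (t - 1)]
  have hq1 : 1 ≤ 1 + t ^ 2 := by nlinarith
  have hqq : 1 + t ^ 2 ≤ (1 + t ^ 2) ^ 2 := by nlinarith
  have hmax0 : 0 ≤ max a b := le_max_of_le_left ha
  have hgen : 0 < max a b → |a ^ α - b ^ α| ≤ 2 * t * max a b ^ (α - 1) := by
    intro hm
    rcases le_total b a with h | h
    · rw [max_eq_left h] at hm ⊢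
      rw [abs_of_nonneg (sub_nonneg.2 (Real.rpow_le_rpow hb h hα0.le))]
      refine (Real.rpow_sub_rpow_le_two_mul hα0 hα2 hb h hm).trans ?_
      gcongr
    · rw [max_eq_right h] at hm ⊢
      rw [abs_sub_comm, abs_of_nonneg (sub_nonneg.2 (Real.rpow_le_rpow ha h hα0.le))]
      refine (Real.rpow_sub_rpow_le_two_mul hα0 hα2 ha h hm).trans ?_
      gcongr
      linarith
  have hmb : max a b ≤ b + t := max_le (by linarith) (by linarith)
  have hB : 0 < (1 + b ^ 2) ^ ((α - 1) / 2) := by positivity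
  have sq_rpow : ∀ c : ℝ, 0 ≤ c → c ^ (α - 1) = (c ^ 2) ^ ((α - 1) / 2) := by
    intro c hc
    rw [← Real.rpow_natCast, ← Real.rpow_mul hc]
    congr 1; push_cast; ring
  have two_rpow : ∀ r : ℝ, r ≤ 1 → (2 : ℝ) ^ r ≤ 2 := fun r hr => by
    simpa using Real.rpow_le_rpow_of_exponent_le (by norm_num : (1 : ℝ) ≤ 2) hr
  rcases le_total 1 α with h1 | h1
  -- For `α ≥ 1` the power `α - 1` is nondecreasing, so the upper bound `max a b ≤ b + t` is the
  -- useful one.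
  · rcases hmax0.eq_or_lt with hm | hm
    · have ha' : a = 0 := le_antisymm (hm ▸ le_max_left a b) ha
      have hb' : b = 0 := le_antisymm (hm ▸ le_max_right a b) hb
      rw [ha', hb', sub_self, abs_zero]
      positivity
    · refine (hgen hm).trans ?_
      have h3 : max a b ^ (α - 1) ≤ 2 * (1 + t ^ 2) * (1 + b ^ 2) ^ ((α - 1) / 2) := by
        rw [sq_rpow _ hmax0]
        have : max a b ^ 2 ≤ 2 * (1 + t ^ 2) * (1 + b ^ 2) :=
          (pow_le_pow_left₀ hmax0 hmb 2).trans
            (by nlinarith [sq_nonneg (b - t), mul_nonneg (sq_nonneg b) (sq_nonneg t)])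
        refine (Real.rpow_le_rpow (by positivity) this (by linarith)).trans ?_
        rw [Real.mul_rpow (by positivity) (by positivity),
          Real.mul_rpow (by positivity) (by positivity)]
        gcongr
        · exact two_rpow _ (by linarith)
        · simpa using Real.rpow_le_rpow_of_exponent_le hq1 (by linarith : (α - 1) / 2 ≤ 1)
      calc 2 * t * max a b ^ (α - 1)
          ≤ 2 * (1 + t ^ 2) * (2 * (1 + t ^ 2) * (1 + b ^ 2) ^ ((α - 1) / 2)) := by gcongr
        _ = _ := by ring
  -- For `α ≤ 1` the power `α - 1` is nonincreasing, so `b ≤ max a b` is used instead; it suffices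
  -- once `b ≥ 1`, where `b²` is comparable to `1 + b²`.
  · have h2 : 1 ≤ 2 * (2 : ℝ) ^ ((α - 1) / 2) := by
      have := two_rpow (-((α - 1) / 2)) (by linarith)
      rw [Real.rpow_neg (by norm_num)] at this
      have hp : (0 : ℝ) < 2 ^ ((α - 1) / 2) := by positivity
      rwa [inv_le_iff_one_le_mul₀ hp] at this
    rcases le_total 1 b with hb1 | hb1
    · have hb0 : 0 < b := by linarith
      refine (hgen (lt_max_of_lt_right hb0)).trans ?_
      have h3 : max a b ^ (α - 1) ≤ 2 * (1 + b ^ 2) ^ ((α - 1) / 2) := by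
        refine (Real.rpow_le_rpow_of_nonpos hb0 (le_max_right a b) (by linarith)).trans ?_
        rw [sq_rpow b hb]
        have h4 : (1 + b ^ 2) / 2 ≤ b ^ 2 := by nlinarith
        refine (Real.rpow_le_rpow_of_nonpos (by positivity) h4 (by linarith)).trans ?_
        rw [Real.div_rpow (by positivity) (by norm_num), div_le_iff₀ (by positivity)]
        nlinarith
      calc 2 * t * max a b ^ (α - 1)
          ≤ 2 * (1 + t ^ 2) * (2 * (1 + b ^ 2) ^ ((α - 1) / 2)) := by gcongr
        _ = 4 * (1 + t ^ 2) * (1 + b ^ 2) ^ ((α - 1) / 2) := by ring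
        _ ≤ _ := by gcongr
    -- For `b ≤ 1` the symbol may fail to be Lipschitz near `0`, but both powers are at most `1 + t`
    -- and the weight at `b` is at least `1/2`.
    · have h5 : |a ^ α - b ^ α| ≤ 2 * (1 + t ^ 2) := by
        have h6 : ∀ c : ℝ, 0 ≤ c → c ≤ 1 + t → c ^ α ≤ 1 + t := fun c hc hc' =>
          (Real.rpow_le_rpow hc hc' hα0.le).trans
            (by simpa using Real.rpow_le_rpow_of_exponent_le (by linarith : 1 ≤ 1 + t) h1)
        have ha' := h6 a ha (by linarith)
        have hb' := h6 b hb (by linarith)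
        have := Real.rpow_nonneg ha α
        have := Real.rpow_nonneg hb α
        rw [abs_le]; constructor <;> linarith
      have h7 : 1 ≤ 2 * (1 + b ^ 2) ^ ((α - 1) / 2) := by
        refine h2.trans ?_
        gcongr 2 * ?_
        exact Real.rpow_le_rpow_of_nonpos (by positivity) (by nlinarith) (by linarith)
      calc |a ^ α - b ^ α| ≤ 2 * (1 + t ^ 2) * 1 := by linarith
        _ ≤ 2 * (1 + t ^ 2) ^ 2 * (2 * (1 + b ^ 2) ^ ((α - 1) / 2)) := by gcongr
        _ = _ := by ring

/-- Peetre's inequality: it moves a polynomial weight across a convolution at the cost of a weight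
on the kernel. -/
theorem one_add_norm_sq_le {E : Type*} [SeminormedAddCommGroup E] (x y : E) :
    1 + ‖x‖ ^ 2 ≤ 2 * (1 + ‖x - y‖ ^ 2) * (1 + ‖y‖ ^ 2) := by
  have h : ‖x‖ ≤ ‖x - y‖ + ‖y‖ := by simpa using norm_add_le (x - y) y
  have := pow_le_pow_left₀ (norm_nonneg x) h 2
  nlinarith [sq_nonneg (‖x - y‖ - ‖y‖), mul_nonneg (sq_nonneg ‖x - y‖) (sq_nonneg ‖y‖)]

/-! ### Young's inequality and dominated integral operators on `L²`. -/

theorem eLpNorm_two_sq {X F : Type*} [MeasurableSpace X] [NormedAddCommGroup F] (μ : Measure X)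
    (f : X → F) : eLpNorm f 2 μ ^ 2 = ∫⁻ x, ‖f x‖ₑ ^ 2 ∂μ := by
  have := eLpNorm_nnreal_pow_eq_lintegral (μ := μ) (f := f) (p := 2) (by norm_num)
  simpa using this

/-- Cauchy–Schwarz for the splitting `k f = k^(1/2) · (k^(1/2) f)`. -/
theorem lintegral_mul_sq_le {X : Type*} [MeasurableSpace X] {μ : Measure X} {k f : X → ℝ≥0∞}
    (hk : AEMeasurable k μ) (hf : AEMeasurable f μ) :
    (∫⁻ x, k x * f x ∂μ) ^ 2 ≤ (∫⁻ x, k x ∂μ) * ∫⁻ x, k x * f x ^ 2 ∂μ := by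
  have hs : ∀ c : ℝ≥0∞, (c ^ (1 / 2 : ℝ)) ^ 2 = c := fun c => by
    rw [← ENNReal.rpow_natCast, ← ENNReal.rpow_mul]; norm_num
  have h := ENNReal.lintegral_mul_le_Lp_mul_Lq μ Real.HolderConjugate.two_two
    (hk.pow_const (1 / 2 : ℝ)) ((hk.pow_const (1 / 2 : ℝ)).mul hf)
  have e : ∀ x, ((fun x => k x ^ (1 / 2 : ℝ)) * ((fun x => k x ^ (1 / 2 : ℝ)) * f)) x
      = k x * f x := fun x => by
    simp only [Pi.mul_apply]
    rw [← mul_assoc, ← sq, hs]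
  simp only [e, Pi.mul_apply, ENNReal.rpow_two, mul_pow, hs] at h
  refine (pow_le_pow_left' h 2).trans ?_
  rw [mul_pow, hs, hs]

section Kernel

variable {E : Type*} [NormedAddCommGroup E] [MeasurableSpace E] [BorelSpace E]
  [SecondCountableTopology E] {μ : Measure E} [SFinite μ] [μ.IsAddLeftInvariant]
  [μ.IsNegInvariant]

/-- Young's inequality `L¹ * L² → L²`. -/
theorem lintegral_convolution_sq_le {k f : E → ℝ≥0∞}
    (hk : AEMeasurable k μ) (hf : AEMeasurable f μ) :
    ∫⁻ x, (∫⁻ y, k (x - y) * f y ∂μ) ^ 2 ∂μ ≤ (∫⁻ x, k x ∂μ) ^ 2 * ∫⁻ y, f y ^ 2 ∂μ := by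
  have hkm : AEMeasurable (fun p : E × E => k (p.1 - p.2)) (μ.prod μ) :=
    hk.comp_quasiMeasurePreserving (quasiMeasurePreserving_sub μ μ)
  have hks : ∀ x, AEMeasurable (fun y => k (x - y)) μ := fun x =>
    hk.comp_quasiMeasurePreserving (quasiMeasurePreserving_sub_left μ x)
  calc ∫⁻ x, (∫⁻ y, k (x - y) * f y ∂μ) ^ 2 ∂μ
      ≤ ∫⁻ x, (∫⁻ y, k y ∂μ) * ∫⁻ y, k (x - y) * f y ^ 2 ∂μ ∂μ := by
        gcongr with x
        refine (lintegral_mul_sq_le (hks x) hf).trans_eq ?_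
        rw [lintegral_sub_left_eq_self k x]
    _ = (∫⁻ y, k y ∂μ) * ∫⁻ y, ∫⁻ x, k (x - y) * f y ^ 2 ∂μ ∂μ := by
        have hm : AEMeasurable (fun p : E × E => k (p.1 - p.2) * f p.2 ^ 2) (μ.prod μ) :=
          hkm.mul ((hf.comp_quasiMeasurePreserving Measure.quasiMeasurePreserving_snd).pow_const 2)
        rw [lintegral_const_mul'' _ hm.lintegral_prod_right', lintegral_lintegral_swap hm]
    _ = (∫⁻ y, k y ∂μ) * ∫⁻ y, (∫⁻ x, k x ∂μ) * f y ^ 2 ∂μ := by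
        congr 1
        refine lintegral_congr fun y => ?_
        rw [lintegral_mul_const'', lintegral_sub_right_eq_self k y]
        exact hk.comp_quasiMeasurePreserving
          (measurePreserving_sub_right μ y).quasiMeasurePreserving
    _ = _ := by rw [lintegral_const_mul'' _ (hf.pow_const 2), sq, mul_assoc]

/-- Integral operators whose kernel is dominated by a convolution kernel in `L¹` map `L²` to
`L²`. -/
theorem memLp_two_integral_of_le_convolution {K : E → E → ℂ} {k : E → ℝ} {h : E → ℂ}
    (hK : AEStronglyMeasurable (Function.uncurry K) (μ.prod μ)) (hk : Integrable k μ)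
    (hh : MemLp h 2 μ) (hb : ∀ x y, ‖K x y‖ ≤ k (x - y) * ‖h y‖) :
    (∀ᵐ x ∂μ, Integrable (K x) μ) ∧ MemLp (fun x => ∫ y, K x y ∂μ) 2 μ ∧
      eLpNorm (fun x => ∫ y, K x y ∂μ) 2 μ ≤ (∫⁻ x, ‖k x‖ₑ ∂μ) * eLpNorm h 2 μ := by
  have hbe : ∀ x y, ‖K x y‖ₑ ≤ ‖k (x - y)‖ₑ * ‖h y‖ₑ := fun x y => by
    rw [← enorm_norm (h y), ← enorm_mul, ← enorm_norm (K x y)]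
    rw [Real.enorm_eq_ofReal (norm_nonneg _),
      Real.enorm_eq_ofReal ((norm_nonneg _).trans (hb x y))]
    exact ENNReal.ofReal_le_ofReal (hb x y)
  have hY := lintegral_convolution_sq_le hk.1.enorm hh.1.enorm
  rw [← eLpNorm_two_sq, ← mul_pow] at hY
  have hfin : (∫⁻ x, ‖k x‖ₑ ∂μ) * eLpNorm h 2 μ < ⊤ := ENNReal.mul_lt_top hk.2 hh.2
  have hle : eLpNorm (fun x => ∫ y, K x y ∂μ) 2 μ ≤ (∫⁻ x, ‖k x‖ₑ ∂μ) * eLpNorm h 2 μ := by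
    rw [← ENNReal.pow_le_pow_left_iff two_ne_zero, eLpNorm_two_sq]
    refine le_trans (lintegral_mono fun x => ?_) hY
    gcongr
    exact (enorm_integral_le_lintegral_enorm _).trans (lintegral_mono fun y => hbe x y)
  have hKm := hK.prodMk_left
  refine ⟨?_, ⟨hK.integral_prod_right', hle.trans_lt hfin⟩, hle⟩
  have hm : AEMeasurable (fun x => (∫⁻ y, ‖k (x - y)‖ₑ * ‖h y‖ₑ ∂μ) ^ 2) μ := by
    have : AEMeasurable (fun p : E × E => ‖k (p.1 - p.2)‖ₑ * ‖h p.2‖ₑ) (μ.prod μ) :=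
      (hk.1.enorm.comp_quasiMeasurePreserving (quasiMeasurePreserving_sub μ μ)).mul
        (hh.1.enorm.comp_quasiMeasurePreserving Measure.quasiMeasurePreserving_snd)
    exact this.lintegral_prod_right'.pow_const 2
  -- Finiteness of the integral in Young's inequality forces the inner integral to be finite almost
  -- everywhere.
  have hae := ae_lt_top' hm (hY.trans_lt (ENNReal.pow_lt_top hfin)).ne
  filter_upwards [hae, hKm] with x hx hx'
  refine ⟨hx', lt_of_le_of_lt (lintegral_mono fun y => hbe x y) ?_⟩
  exact (ENNReal.pow_lt_top_iff.1 hx).resolve_right two_ne_zero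

end Kernel

/-! ### Square integrability up to a polynomial weight. -/

/-- `g` is square integrable up to a polynomial weight. -/
def IsTemperedL2 {d : ℕ} (g : EuclideanSpace ℝ (Fin d) → ℂ) : Prop :=
  ∃ N : ℕ, MemLp (fun ξ => ((((1 + ‖ξ‖ ^ 2) ^ N)⁻¹ : ℝ) : ℂ) * g ξ) 2 volume

variable {d : ℕ} {g : EuclideanSpace ℝ (Fin d) → ℂ}

theorem one_add_norm_sq_pow_cast_ne_zero (ξ : EuclideanSpace ℝ (Fin d)) (N : ℕ) :
    (((1 + ‖ξ‖ ^ 2) ^ N : ℝ) : ℂ) ≠ 0 :=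
  Complex.ofReal_ne_zero.2 (by positivity)

theorem hasTemperateGrowth_one_add_norm_sq_pow (N : ℕ) :
    (fun ξ : EuclideanSpace ℝ (Fin d) => (((1 + ‖ξ‖ ^ 2) ^ N : ℝ) : ℂ)).HasTemperateGrowth := by
  have : (fun ξ : EuclideanSpace ℝ (Fin d) =>
      (((1 + ‖ξ‖ ^ 2) ^ (N : ℝ) : ℝ) : ℂ)).HasTemperateGrowth := by
    fun_prop
  simpa only [Real.rpow_natCast] using this

theorem IsTemperedL2.aestronglyMeasurable (hg : IsTemperedL2 g) :
    AEStronglyMeasurable g volume := by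
  obtain ⟨N, hN⟩ := hg
  have hc : Continuous fun ξ : EuclideanSpace ℝ (Fin d) => (((1 + ‖ξ‖ ^ 2) ^ N : ℝ) : ℂ) := by
    fun_prop
  refine (hc.aestronglyMeasurable.mul hN.1).congr (ae_of_all _ fun ξ => ?_)
  simp only [Pi.mul_apply, Complex.ofReal_inv]
  rw [mul_inv_cancel_left₀ (one_add_norm_sq_pow_cast_ne_zero ξ N)]

/-- Lets the convolution result be applied to `|b|` and `|g|`, as Fubini's theorem requires. -/
theorem IsTemperedL2.norm (hg : IsTemperedL2 g) : IsTemperedL2 fun ξ => ((‖g ξ‖ : ℝ) : ℂ) := by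
  obtain ⟨N, hN⟩ := hg
  refine ⟨N, (hN.norm.ofReal (K := ℂ)).congr_norm ?_ (ae_of_all _ fun ξ => by simp)⟩
  refine (hN.norm.ofReal (K := ℂ)).1.congr (ae_of_all _ fun ξ => ?_)
  have h : (0 : ℝ) ≤ ((1 + ‖ξ‖ ^ 2) ^ N)⁻¹ := by positivity
  simp only [norm_mul, Complex.norm_real, Real.norm_of_nonneg h]
  simp

theorem IsTemperedL2.integrable_schwartz_mul (hg : IsTemperedL2 g)
    (φ : 𝓢(EuclideanSpace ℝ (Fin d), ℂ)) : Integrable fun ξ => φ ξ * g ξ := by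
  obtain ⟨N, hN⟩ := hg
  have h := (SchwartzMap.smulLeftCLM ℂ (fun ξ => (((1 + ‖ξ‖ ^ 2) ^ N : ℝ) : ℂ)) φ).memLp 2 volume
  refine (h.integrable_mul hN).congr (ae_of_all _ fun ξ => ?_)
  have := one_add_norm_sq_pow_cast_ne_zero ξ N
  simp only [Pi.mul_apply, Complex.ofReal_inv,
    SchwartzMap.smulLeftCLM_apply_apply (hasTemperateGrowth_one_add_norm_sq_pow N), smul_eq_mul]
  field_simp

/-- The distribution is the inverse Fourier transform of a polynomial weight times an `L²` function.
-/
theorem IsTemperedL2.exists_hasFourierDensity (hg : IsTemperedL2 g) :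
    ∃ v : 𝓢'(EuclideanSpace ℝ (Fin d), ℂ), HasFourierDensity v g := by
  have hint := hg.integrable_schwartz_mul
  obtain ⟨N, hN⟩ := hg
  refine ⟨𝓕⁻ (smulLeftCLM ℂ (fun ξ => (((1 + ‖ξ‖ ^ 2) ^ N : ℝ) : ℂ))
    (hN.toLp : 𝓢'(EuclideanSpace ℝ (Fin d), ℂ))), hint, fun φ => ?_⟩
  rw [fourier_fourierInv_eq, smulLeftCLM_apply_apply, Lp.toTemperedDistribution_apply]
  refine integral_congr_ae ?_
  filter_upwards [hN.coeFn_toLp] with ξ hξ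
  have := one_add_norm_sq_pow_cast_ne_zero ξ N
  rw [hξ]
  simp only [Complex.ofReal_inv,
    SchwartzMap.smulLeftCLM_apply_apply (hasTemperateGrowth_one_add_norm_sq_pow N), smul_eq_mul]
  field_simp

theorem IsTemperedL2.mul_of_le (hg : IsTemperedL2 g) {m : EuclideanSpace ℝ (Fin d) → ℝ}
    (hm : Continuous m) {C : ℝ} {M : ℕ} (hC : ∀ ξ, |m ξ| ≤ C * (1 + ‖ξ‖ ^ 2) ^ M) :
    IsTemperedL2 fun ξ => (m ξ : ℂ) * g ξ := by
  have hgm := hg.aestronglyMeasurable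
  obtain ⟨N, hN⟩ := hg
  refine ⟨N + M, hN.of_le_mul (c := C) ?_ (ae_of_all _ fun ξ => ?_)⟩
  · have hc : Continuous fun ξ : EuclideanSpace ℝ (Fin d) =>
        ((((1 + ‖ξ‖ ^ 2) ^ (N + M))⁻¹ : ℝ) : ℂ) := by
      refine Complex.continuous_ofReal.comp (Continuous.inv₀ (by fun_prop) fun ξ => by positivity)
    exact hc.aestronglyMeasurable.mul
      ((Complex.continuous_ofReal.comp hm).aestronglyMeasurable.mul hgm)
  · have h1 : (0 : ℝ) < (1 + ‖ξ‖ ^ 2) ^ N := by positivity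
    have h2 : (0 : ℝ) < (1 + ‖ξ‖ ^ 2) ^ M := by positivity
    simp only [norm_mul, Complex.norm_real, Real.norm_eq_abs, pow_add, mul_inv,
      abs_of_pos (inv_pos.2 h1), abs_of_pos (inv_pos.2 h2)]
    have h3 : ((1 + ‖ξ‖ ^ 2) ^ M)⁻¹ * |m ξ| ≤ C := by
      rw [inv_mul_le_iff₀ h2, mul_comm]; exact hC ξ
    calc ((1 + ‖ξ‖ ^ 2) ^ N)⁻¹ * ((1 + ‖ξ‖ ^ 2) ^ M)⁻¹ * (|m ξ| * ‖g ξ‖)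
        = ((1 + ‖ξ‖ ^ 2) ^ M)⁻¹ * |m ξ| * (((1 + ‖ξ‖ ^ 2) ^ N)⁻¹ * ‖g ξ‖) := by ring
      _ ≤ _ := by gcongr

theorem aestronglyMeasurable_sub_mul {b : EuclideanSpace ℝ (Fin d) → ℂ} (hb : Continuous b)
    (hg : AEStronglyMeasurable g volume) :
    AEStronglyMeasurable (fun p : EuclideanSpace ℝ (Fin d) × EuclideanSpace ℝ (Fin d) =>
      b (p.1 - p.2) * g p.2) (volume.prod volume) :=
  (hb.comp (continuous_fst.sub continuous_snd)).aestronglyMeasurable.mul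
    (hg.comp_quasiMeasurePreserving Measure.quasiMeasurePreserving_snd)

theorem SchwartzMap.integrable_one_add_norm_sq_pow_mul_norm
    (b : 𝓢(EuclideanSpace ℝ (Fin d), ℂ)) (N : ℕ) :
    Integrable fun ξ => (1 + ‖ξ‖ ^ 2) ^ N * ‖b ξ‖ := by
  have h := (SchwartzMap.smulLeftCLM ℂ (fun ξ => (((1 + ‖ξ‖ ^ 2) ^ N : ℝ) : ℂ)) b).integrable
    (μ := volume)
  refine h.norm.congr (ae_of_all _ fun ξ => ?_)
  have h1 : (0 : ℝ) ≤ (1 + ‖ξ‖ ^ 2) ^ N := by positivity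
  simp only [SchwartzMap.smulLeftCLM_apply_apply (hasTemperateGrowth_one_add_norm_sq_pow N),
    smul_eq_mul, norm_mul, Complex.norm_real, Real.norm_of_nonneg h1]

/-- Convolution with a function of rapid decay preserves square integrability up to a polynomial
weight. -/
theorem IsTemperedL2.convolution (hg : IsTemperedL2 g) {b : EuclideanSpace ℝ (Fin d) → ℂ}
    (hb : Continuous b) (hbi : ∀ N : ℕ, Integrable fun ξ => (1 + ‖ξ‖ ^ 2) ^ N * ‖b ξ‖) :
    (∀ᵐ ξ, Integrable fun η => b (ξ - η) * g η) ∧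
      IsTemperedL2 fun ξ => ∫ η, b (ξ - η) * g η := by
  have hgm := hg.aestronglyMeasurable
  obtain ⟨N, hN⟩ := hg
  have hc : Continuous fun ξ : EuclideanSpace ℝ (Fin d) =>
      ((((1 + ‖ξ‖ ^ 2) ^ N)⁻¹ : ℝ) : ℂ) :=
    Complex.continuous_ofReal.comp (Continuous.inv₀ (by fun_prop) fun ξ => by positivity)
  -- Conjugating by the weight reduces to a bound on `L²`; Peetre's inequality transfers the weight
  -- from `ξ` to `η`, and the decay of `b` absorbs the loss.
  have hK : AEStronglyMeasurable (Function.uncurry fun ξ η : EuclideanSpace ℝ (Fin d) =>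
      ((((1 + ‖ξ‖ ^ 2) ^ N)⁻¹ : ℝ) : ℂ) * (b (ξ - η) * g η)) (volume.prod volume) :=
    (hc.comp continuous_fst).aestronglyMeasurable.mul (aestronglyMeasurable_sub_mul hb hgm)
  have hbd : ∀ ξ η : EuclideanSpace ℝ (Fin d),
      ‖((((1 + ‖ξ‖ ^ 2) ^ N)⁻¹ : ℝ) : ℂ) * (b (ξ - η) * g η)‖ ≤
        2 ^ N * ((1 + ‖ξ - η‖ ^ 2) ^ N * ‖b (ξ - η)‖) *
          ‖((((1 + ‖η‖ ^ 2) ^ N)⁻¹ : ℝ) : ℂ) * g η‖ := by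
    intro ξ η
    have h1 : (0 : ℝ) < (1 + ‖ξ‖ ^ 2) ^ N := by positivity
    have h2 : (0 : ℝ) < (1 + ‖η‖ ^ 2) ^ N := by positivity
    have h3 : (1 + ‖η‖ ^ 2) ^ N ≤ 2 ^ N * (1 + ‖ξ - η‖ ^ 2) ^ N * (1 + ‖ξ‖ ^ 2) ^ N := by
      rw [← mul_pow, ← mul_pow, norm_sub_rev]
      exact pow_le_pow_left₀ (by positivity) (one_add_norm_sq_le η ξ) N
    simp only [norm_mul, Complex.norm_real, Real.norm_eq_abs,
      abs_of_pos (inv_pos.2 h1), abs_of_pos (inv_pos.2 h2)]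
    have h4 : ((1 + ‖ξ‖ ^ 2) ^ N)⁻¹ ≤
        2 ^ N * (1 + ‖ξ - η‖ ^ 2) ^ N * ((1 + ‖η‖ ^ 2) ^ N)⁻¹ := by
      rw [← div_eq_mul_inv, inv_le_iff_one_le_mul₀ h1, div_mul_eq_mul_div, le_div_iff₀ h2]
      simpa using h3
    calc _ ≤ 2 ^ N * (1 + ‖ξ - η‖ ^ 2) ^ N * ((1 + ‖η‖ ^ 2) ^ N)⁻¹ *
          (‖b (ξ - η)‖ * ‖g η‖) := by gcongr
      _ = _ := by ring
  obtain ⟨h1, h2, -⟩ := memLp_two_integral_of_le_convolution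
    (k := fun ξ => 2 ^ N * ((1 + ‖ξ‖ ^ 2) ^ N * ‖b ξ‖)) hK ((hbi N).const_mul _) hN hbd
  refine ⟨?_, N, by simpa only [integral_const_mul] using h2⟩
  filter_upwards [h1] with ξ hξ
  refine (hξ.const_mul (((1 + ‖ξ‖ ^ 2) ^ N : ℝ) : ℂ)).congr (ae_of_all _ fun η => ?_)
  simp only [Complex.ofReal_inv]
  rw [mul_inv_cancel_left₀ (one_add_norm_sq_pow_cast_ne_zero ξ N)]

theorem IsTemperedL2.integrable_prod (hg : IsTemperedL2 g)
    (b φ : 𝓢(EuclideanSpace ℝ (Fin d), ℂ)) :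
    Integrable (fun p : EuclideanSpace ℝ (Fin d) × EuclideanSpace ℝ (Fin d) =>
      φ p.1 * (b (p.1 - p.2) * g p.2)) (volume.prod volume) := by
  have hm : AEStronglyMeasurable
      (fun p : EuclideanSpace ℝ (Fin d) × EuclideanSpace ℝ (Fin d) =>
        φ p.1 * (b (p.1 - p.2) * g p.2)) (volume.prod volume) :=
    (φ.continuous.comp continuous_fst).aestronglyMeasurable.mul
      (aestronglyMeasurable_sub_mul b.continuous hg.aestronglyMeasurable)
  rw [integrable_prod_iff hm]
  constructor
  · filter_upwards [(hg.convolution b.continuous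
      b.integrable_one_add_norm_sq_pow_mul_norm).1] with ξ hξ
    exact hξ.const_mul _
  · have h := (hg.norm.convolution (b := fun ξ => ((‖b ξ‖ : ℝ) : ℂ))
      (Complex.continuous_ofReal.comp b.continuous.norm)
      (by simpa using b.integrable_one_add_norm_sq_pow_mul_norm)).2.integrable_schwartz_mul φ
    refine h.norm.congr (ae_of_all _ fun ξ => ?_)
    simp only [norm_mul, integral_const_mul]
    congr 1
    simp only [← Complex.ofReal_mul]
    rw [integral_complex_ofReal, Complex.norm_real, Real.norm_of_nonneg]
    exact integral_nonneg fun η => by positivity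

/-! ### Fourier densities of products, differences and Bessel potentials. -/

/-- The transpose of convolution with `𝓕 B`. The product is the Fourier transform of `φ * 𝓕⁻ B`, and
`𝓕⁻ B (η - ξ) = 𝓕 B (ξ - η)`. -/
theorem SchwartzMap.fourierInv_smul_fourier_apply (B φ : 𝓢(EuclideanSpace ℝ (Fin d), ℂ))
    (η : EuclideanSpace ℝ (Fin d)) :
    𝓕⁻ (SchwartzMap.smulLeftCLM ℂ B (𝓕 φ)) η = ∫ ξ, φ ξ * 𝓕 B (ξ - η) := by
  have e : SchwartzMap.smulLeftCLM ℂ B (𝓕 φ) =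
      𝓕 (SchwartzMap.convolution (ContinuousLinearMap.mul ℂ ℂ) φ (𝓕⁻ B)) := by
    rw [SchwartzMap.fourier_convolution, fourier_fourierInv_eq]
    ext x
    rw [SchwartzMap.smulLeftCLM_apply_apply B.hasTemperateGrowth, SchwartzMap.pairing_apply_apply]
    simp [mul_comm]
  rw [e, fourierInv_fourier_eq, SchwartzMap.convolution_apply]
  refine integral_congr_ae (ae_of_all _ fun ξ => ?_)
  simp only [ContinuousLinearMap.mul_apply', SchwartzMap.fourierInv_coe, SchwartzMap.fourier_coe,
    Real.fourierInv_eq_fourier_neg, neg_sub]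

/-- The Fourier transform turns multiplication by a Schwartz function into convolution. -/
theorem HasFourierDensity.smulLeftCLM {u : 𝓢'(EuclideanSpace ℝ (Fin d), ℂ)}
    (hu : HasFourierDensity u g) (hg : IsTemperedL2 g) (B : 𝓢(EuclideanSpace ℝ (Fin d), ℂ)) :
    HasFourierDensity (TemperedDistribution.smulLeftCLM ℂ B u)
      (fun ξ => ∫ η, 𝓕 B (ξ - η) * g η) := by
  refine ⟨((hg.convolution (𝓕 B).continuous
    (𝓕 B).integrable_one_add_norm_sq_pow_mul_norm).2).integrable_schwartz_mul, fun φ => ?_⟩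
  have e1 : (𝓕 (TemperedDistribution.smulLeftCLM ℂ B u)) φ =
      (𝓕 u) (𝓕⁻ (SchwartzMap.smulLeftCLM ℂ B (𝓕 φ))) := by
    rw [TemperedDistribution.fourier_apply, TemperedDistribution.fourier_apply,
      smulLeftCLM_apply_apply, fourier_fourierInv_eq]
  rw [e1, hu.apply_eq]
  simp_rw [SchwartzMap.fourierInv_smul_fourier_apply, ← integral_const_mul, ← integral_mul_const]
  rw [integral_integral_swap]
  · simp_rw [mul_assoc]
  · have := (hg.integrable_prod (𝓕 B) φ).swap
    refine this.congr (ae_of_all _ fun p => ?_)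
    simp [Function.uncurry, mul_assoc]

theorem HasFourierDensity.sub {u v : 𝓢'(EuclideanSpace ℝ (Fin d), ℂ)}
    {g g' : EuclideanSpace ℝ (Fin d) → ℂ} (h : HasFourierDensity u g)
    (h' : HasFourierDensity v g') : HasFourierDensity (u - v) (fun ξ => g ξ - g' ξ) := by
  refine ⟨fun φ => ?_, fun φ => ?_⟩
  · simp only [mul_sub]
    exact (h.integrable φ).sub (h'.integrable φ)
  · simp only [mul_sub]
    rw [integral_sub (h.integrable φ) (h'.integrable φ), ← h.apply_eq, ← h'.apply_eq]
    rfl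

theorem HasFourierDensity.eq {u v : 𝓢'(EuclideanSpace ℝ (Fin d), ℂ)}
    {g g' : EuclideanSpace ℝ (Fin d) → ℂ} (h : HasFourierDensity u g)
    (h' : HasFourierDensity v g') (hgg' : g =ᵐ[volume] g') : u = v := by
  have : 𝓕 u = 𝓕 v := by
    ext φ
    rw [h.apply_eq, h'.apply_eq]
    refine integral_congr_ae ?_
    filter_upwards [hgg'] with x hx
    rw [hx]
  simpa using congrArg (fun z : 𝓢'(EuclideanSpace ℝ (Fin d), ℂ) => 𝓕⁻ z) this

theorem hasFourierDensity_fourierInv_toLp (hg : MemLp g 2 volume) :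
    HasFourierDensity ((𝓕⁻ hg.toLp : Lp ℂ 2 (volume : Measure (EuclideanSpace ℝ (Fin d)))) :
      𝓢'(EuclideanSpace ℝ (Fin d), ℂ)) g := by
  refine ⟨fun φ => (φ.memLp 2 volume).integrable_mul hg, fun φ => ?_⟩
  rw [← Lp.fourierInv_toTemperedDistribution_eq, fourier_fourierInv_eq,
    Lp.toTemperedDistribution_apply]
  refine integral_congr_ae ?_
  filter_upwards [hg.coeFn_toLp] with ξ hξ
  rw [hξ, smul_eq_mul]

/-- The Fourier transform of an element of `H^s`. -/
theorem hasFourierDensity_of_besselPotential_eq {s : ℝ} {u : 𝓢'(EuclideanSpace ℝ (Fin d), ℂ)}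
    {f : Lp ℂ 2 (volume : Measure (EuclideanSpace ℝ (Fin d)))}
    (hf : besselPotential (EuclideanSpace ℝ (Fin d)) ℂ s u = f)
    (hg : IsTemperedL2 fun ξ => (((1 + ‖ξ‖ ^ 2) ^ (-s / 2) : ℝ) : ℂ) * (𝓕 f) ξ) :
    HasFourierDensity u fun ξ => (((1 + ‖ξ‖ ^ 2) ^ (-s / 2) : ℝ) : ℂ) * (𝓕 f) ξ := by
  refine ⟨hg.integrable_schwartz_mul, fun φ => ?_⟩
  have hu : u = besselPotential (EuclideanSpace ℝ (Fin d)) ℂ (-s) f :=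
    ((besselPotential_neg_apply_eq_iff s _ _).2 hf).symm
  have ht : (fun ξ : EuclideanSpace ℝ (Fin d) =>
      (((1 + ‖ξ‖ ^ 2) ^ (-s / 2) : ℝ) : ℂ)).HasTemperateGrowth := by fun_prop
  rw [hu, fourier_besselPotential_eq_smulLeftCLM_fourier_apply,
    Lp.fourier_toTemperedDistribution_eq, smulLeftCLM_apply_apply,
    Lp.toTemperedDistribution_apply]
  refine integral_congr_ae (ae_of_all _ fun ξ => ?_)
  simp only [SchwartzMap.smulLeftCLM_apply_apply ht, smul_eq_mul]
  ring

theorem isTemperedL2_one_add_norm_sq_rpow_mul {f : EuclideanSpace ℝ (Fin d) → ℂ}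
    (hf : MemLp f 2 volume) {r : ℝ} (hr : r ≤ 1) :
    IsTemperedL2 fun ξ => (((1 + ‖ξ‖ ^ 2) ^ r : ℝ) : ℂ) * f ξ := by
  have h0 : IsTemperedL2 f := ⟨0, by simpa using hf⟩
  refine h0.mul_of_le (m := fun ξ => (1 + ‖ξ‖ ^ 2) ^ r) (C := 1) (M := 1) ?_ fun ξ => ?_
  · exact Continuous.rpow_const (by fun_prop) fun ξ => Or.inl (by positivity)
  · rw [abs_of_nonneg (by positivity), one_mul, pow_one]
    simpa using Real.rpow_le_rpow_of_exponent_le (by simp : 1 ≤ 1 + ‖ξ‖ ^ 2) hr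

theorem IsTemperedL2.fracLaplacian_symbol_mul (hg : IsTemperedL2 g) {α : ℝ} (hα0 : 0 < α)
    (hα2 : α < 2) : IsTemperedL2 fun ξ => (((2 * Real.pi * ‖ξ‖) ^ α : ℝ) : ℂ) * g ξ := by
  refine hg.mul_of_le (m := fun ξ => (2 * Real.pi * ‖ξ‖) ^ α) (C := (2 * Real.pi) ^ α) (M := 1)
    ?_ fun ξ => ?_
  · exact Continuous.rpow_const (by fun_prop) fun ξ => Or.inr hα0.le
  · rw [abs_of_nonneg (by positivity), Real.mul_rpow (by positivity) (norm_nonneg _), pow_one]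
    gcongr
    have h1 : ‖ξ‖ ^ α = (‖ξ‖ ^ 2) ^ (α / 2) := by
      rw [← Real.rpow_natCast, ← Real.rpow_mul (norm_nonneg _)]
      congr 1; push_cast; ring
    calc ‖ξ‖ ^ α ≤ (1 + ‖ξ‖ ^ 2) ^ (α / 2) := by
          rw [h1]
          exact Real.rpow_le_rpow (by positivity) (by linarith) (by linarith)
      _ ≤ _ := by
          simpa using Real.rpow_le_rpow_of_exponent_le (by simp : 1 ≤ 1 + ‖ξ‖ ^ 2)
            (by linarith : α / 2 ≤ 1)

theorem IsTemperedL2.exists_hasFracLaplacian (hg : IsTemperedL2 g) {α : ℝ} (hα0 : 0 < α)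
    (hα2 : α < 2) {u : 𝓢'(EuclideanSpace ℝ (Fin d), ℂ)} (hu : HasFourierDensity u g) :
    ∃ v, HasFracLaplacian α u v ∧
      HasFourierDensity v fun ξ => (((2 * Real.pi * ‖ξ‖) ^ α : ℝ) : ℂ) * g ξ := by
  obtain ⟨v, hv⟩ := (hg.fracLaplacian_symbol_mul hα0 hα2).exists_hasFourierDensity
  exact ⟨v, ⟨g, hu, hv⟩, hv⟩

/-! ### The commutator estimate. -/

/-- The kernel of the commutator on the Fourier side is dominated by a convolution kernel. -/
theorem norm_fracCommutator_kernel_le {α : ℝ} (hα0 : 0 < α) (hα2 : α < 2)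
    (b h : EuclideanSpace ℝ (Fin d) → ℂ) (ξ η : EuclideanSpace ℝ (Fin d)) :
    ‖((((2 * Real.pi * ‖η‖) ^ α : ℝ) : ℂ) - (((2 * Real.pi * ‖ξ‖) ^ α : ℝ) : ℂ)) *
      (b (ξ - η) * ((((1 + ‖η‖ ^ 2) ^ (-(α - 1) / 2) : ℝ) : ℂ) * h η))‖ ≤
      (2 * Real.pi) ^ α * 4 * ((1 + ‖ξ - η‖ ^ 2) ^ 2 * ‖b (ξ - η)‖) * ‖h η‖ := by
  have hq : (0 : ℝ) < 1 + ‖η‖ ^ 2 := by positivity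
  have hr := Real.abs_rpow_sub_rpow_le hα0 hα2 (norm_nonneg ξ) (norm_nonneg η)
    (abs_norm_sub_norm_le ξ η)
  -- The order `α - 1` of the Sobolev space is exactly what makes the two weights cancel.
  have hc : (1 + ‖η‖ ^ 2) ^ ((α - 1) / 2) * (1 + ‖η‖ ^ 2) ^ (-(α - 1) / 2) = 1 := by
    rw [← Real.rpow_add hq, neg_div, add_neg_cancel, Real.rpow_zero]
  rw [← Complex.ofReal_sub, norm_mul, norm_mul, norm_mul, Complex.norm_real, Complex.norm_real,
    Real.norm_of_nonneg (Real.rpow_nonneg hq.le _), Real.norm_eq_abs, abs_sub_comm,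
    Real.mul_rpow (by positivity) (norm_nonneg _), Real.mul_rpow (by positivity) (norm_nonneg _),
    ← mul_sub, abs_mul, abs_of_nonneg (by positivity : 0 ≤ (2 * Real.pi) ^ α)]
  calc _ ≤ (2 * Real.pi) ^ α *
        (4 * (1 + ‖ξ - η‖ ^ 2) ^ 2 * (1 + ‖η‖ ^ 2) ^ ((α - 1) / 2)) *
        (‖b (ξ - η)‖ * ((1 + ‖η‖ ^ 2) ^ (-(α - 1) / 2) * ‖h η‖)) := by gcongr
    _ = (2 * Real.pi) ^ α * 4 * ((1 + ‖ξ - η‖ ^ 2) ^ 2 * ‖b (ξ - η)‖) * ‖h η‖ *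
        ((1 + ‖η‖ ^ 2) ^ ((α - 1) / 2) * (1 + ‖η‖ ^ 2) ^ (-(α - 1) / 2)) := by ring
    _ = _ := by rw [hc, mul_one]

/-- The commutator estimate on the Fourier side. -/
theorem memLp_fracCommutator_fourier {α : ℝ} (hα0 : 0 < α) (hα2 : α < 2)
    (b : 𝓢(EuclideanSpace ℝ (Fin d), ℂ)) {h : EuclideanSpace ℝ (Fin d) → ℂ}
    (hh : MemLp h 2 volume)
    (hg : g = fun ξ => (((1 + ‖ξ‖ ^ 2) ^ (-(α - 1) / 2) : ℝ) : ℂ) * h ξ) :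
    ∃ T : EuclideanSpace ℝ (Fin d) → ℂ, ∃ hT : MemLp T 2 volume,
      ((fun ξ => (∫ η, b (ξ - η) * ((((2 * Real.pi * ‖η‖) ^ α : ℝ) : ℂ) * g η)) -
        (((2 * Real.pi * ‖ξ‖) ^ α : ℝ) : ℂ) * ∫ η, b (ξ - η) * g η) =ᵐ[volume] T) ∧
      ‖hT.toLp‖ ≤ (∫ ξ, (2 * Real.pi) ^ α * 4 * ((1 + ‖ξ‖ ^ 2) ^ 2 * ‖b ξ‖)) *
        ‖hh.toLp‖ := by
  have hgt : IsTemperedL2 g := hg ▸ isTemperedL2_one_add_norm_sq_rpow_mul hh (by linarith)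
  have hgi := (hgt.convolution b.continuous b.integrable_one_add_norm_sq_pow_mul_norm).1
  have hgαi := ((hgt.fracLaplacian_symbol_mul hα0 hα2).convolution b.continuous
    b.integrable_one_add_norm_sq_pow_mul_norm).1
  have hcm : Continuous fun ξ : EuclideanSpace ℝ (Fin d) =>
      (((2 * Real.pi * ‖ξ‖) ^ α : ℝ) : ℂ) :=
    Complex.continuous_ofReal.comp
      (Continuous.rpow_const (by fun_prop) fun ξ => Or.inr hα0.le)
  have hKm : AEStronglyMeasurable (Function.uncurry fun ξ η : EuclideanSpace ℝ (Fin d) =>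
      ((((2 * Real.pi * ‖η‖) ^ α : ℝ) : ℂ) - (((2 * Real.pi * ‖ξ‖) ^ α : ℝ) : ℂ)) *
        (b (ξ - η) * g η)) (volume.prod volume) :=
    ((hcm.comp continuous_snd).sub (hcm.comp continuous_fst)).aestronglyMeasurable.mul
      (aestronglyMeasurable_sub_mul b.continuous hgt.aestronglyMeasurable)
  have hki : Integrable fun ξ : EuclideanSpace ℝ (Fin d) =>
      (2 * Real.pi) ^ α * 4 * ((1 + ‖ξ‖ ^ 2) ^ 2 * ‖b ξ‖) :=
    (b.integrable_one_add_norm_sq_pow_mul_norm 2).const_mul _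
  obtain ⟨-, hT, hTle⟩ := memLp_two_integral_of_le_convolution hKm hki hh
    (fun ξ η => by rw [hg]; exact norm_fracCommutator_kernel_le hα0 hα2 b h ξ η)
  refine ⟨_, hT, ?_, ?_⟩
  -- For almost every `ξ` the two convolutions converge separately, so their difference is a single
  -- integral.
  · filter_upwards [hgi, hgαi] with ξ h1 h2
    rw [← integral_const_mul, ← integral_sub h2 (h1.const_mul _)]
    refine integral_congr_ae (ae_of_all _ fun η => ?_)
    ring
  · rw [Lp.norm_toLp, Lp.norm_toLp,
      integral_eq_lintegral_of_nonneg_ae (ae_of_all _ fun ξ => by positivity) hki.1,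
      ← ENNReal.toReal_mul]
    have e : ∀ ξ : EuclideanSpace ℝ (Fin d),
        ENNReal.ofReal ((2 * Real.pi) ^ α * 4 * ((1 + ‖ξ‖ ^ 2) ^ 2 * ‖b ξ‖)) =
          ‖(2 * Real.pi) ^ α * 4 * ((1 + ‖ξ‖ ^ 2) ^ 2 * ‖b ξ‖)‖ₑ := fun ξ =>
      (Real.enorm_eq_ofReal (by positivity)).symm
    simp only [e]
    exact ENNReal.toReal_mono (ENNReal.mul_lt_top hki.2 hh.2).ne hTle

/-- The commutator estimate `H^{α-1} → L²`, with an explicit constant, for multiplication by a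
Schwartz function. -/
theorem fracCommutator_schwartz_bound {α : ℝ} (hα0 : 0 < α) (hα2 : α < 2)
    (B : 𝓢(EuclideanSpace ℝ (Fin d), ℂ)) {u : 𝓢'(EuclideanSpace ℝ (Fin d), ℂ)}
    (hu : MemSobolev (α - 1) 2 u) :
    (∃ v, HasFracLaplacian α u v) ∧ (∃ w, HasFracLaplacian α (smulLeftCLM ℂ B u) w) ∧
      ∃ f : Lp ℂ 2 (volume : Measure (EuclideanSpace ℝ (Fin d))),
        fracCommutator α B u = f ∧
        ‖f‖ ≤ (∫ ξ, (2 * Real.pi) ^ α * 4 * ((1 + ‖ξ‖ ^ 2) ^ 2 * ‖𝓕 B ξ‖)) *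
          sobolevNorm (α - 1) u := by
  obtain ⟨f₀, hf₀⟩ := hu
  have hh : MemLp (𝓕 f₀ : Lp ℂ 2 (volume : Measure (EuclideanSpace ℝ (Fin d)))) 2 volume :=
    Lp.memLp _
  have hg := isTemperedL2_one_add_norm_sq_rpow_mul hh (by linarith : -(α - 1) / 2 ≤ 1)
  have hug := hasFourierDensity_of_besselPotential_eq hf₀ hg
  obtain ⟨v, huv, hv⟩ := hg.exists_hasFracLaplacian hα0 hα2 hug
  obtain ⟨w, hBuw, hw⟩ := ((hg.convolution (𝓕 B).continuous
    (𝓕 B).integrable_one_add_norm_sq_pow_mul_norm).2).exists_hasFracLaplacian hα0 hα2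
      (hug.smulLeftCLM hg B)
  have hD := (hv.smulLeftCLM (hg.fracLaplacian_symbol_mul hα0 hα2) B).sub hw
  obtain ⟨T, hT, hDT, hle⟩ := memLp_fracCommutator_fourier hα0 hα2 (𝓕 B) hh rfl
  refine ⟨⟨v, huv⟩, ⟨w, hBuw⟩, 𝓕⁻ hT.toLp, ?_, ?_⟩
  · rw [fracCommutator, huv.fracLaplacian_eq, hBuw.fracLaplacian_eq]
    exact hD.eq (hasFourierDensity_fourierInv_toLp hT) hDT
  -- Plancherel on both sides passes to the norms of `T` and `𝓕 f₀`.
  · rw [sobolevNorm_eq hf₀, ← Lp.norm_fourier_eq, fourier_fourierInv_eq, ← Lp.norm_fourier_eq f₀]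
    rwa [Lp.toLp_coeFn] at hle

end

theorem mainTheorem12 (d : ℕ) (hd : 1 ≤ d) (α : ℝ) (hα0 : 0 < α) (hα2 : α < 2)
    (β : EuclideanSpace ℝ (Fin d) → ℂ) (hβ : ContDiff ℝ ∞ β) (hβc : HasCompactSupport β) :
    ∃ C : ℝ, 0 < C ∧ ∀ u : 𝓢'(EuclideanSpace ℝ (Fin d), ℂ), MemSobolev (α - 1) 2 u →
      (∃ v, HasFracLaplacian α u v) ∧
      (∃ w, HasFracLaplacian α (smulLeftCLM ℂ β u) w) ∧
      ∃ f : Lp ℂ 2 (volume : Measure (EuclideanSpace ℝ (Fin d))),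
        fracCommutator α β u = f ∧ ‖f‖ ≤ C * sobolevNorm (α - 1) u := by
  set B := hβc.toSchwartzMap hβ with hB
  have hBβ : (B : EuclideanSpace ℝ (Fin d) → ℂ) = β := rfl
  set C₀ := ∫ ξ, (2 * Real.pi) ^ α * 4 * ((1 + ‖ξ‖ ^ 2) ^ 2 * ‖𝓕 B ξ‖)
  have hC₀ : 0 ≤ C₀ := integral_nonneg fun ξ => by positivity
  -- `C₀` vanishes when `β = 0`; adding `1` keeps the constant positive.
  refine ⟨C₀ + 1, by linarith, fun u hu => ?_⟩
  obtain ⟨hv, hw, f, hf, hle⟩ := fracCommutator_schwartz_bound hα0 hα2 B hu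
  rw [hBβ] at hw hf
  refine ⟨hv, hw, f, hf, hle.trans ?_⟩
  have hn : 0 ≤ sobolevNorm (α - 1) u := by
    obtain ⟨f₀, hf₀⟩ := hu
    rw [sobolevNorm_eq hf₀]
    exact norm_nonneg _
  gcongr
  linarith
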